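/- Let $T>0$ and let $\{\Gamma(t)\}_{t\in[0,T]}$ be a $C^2$-evolving surface in $\mathbb R^3$: $\Gamma_0$ is a compact, connected, embedded (hence orientable) $C^2$-surface without boundary, and $\Gamma(t)=\Phi_t(\Gamma_0)$, where each $\Phi_t\colon\Gamma_0\to\Gamma(t)$ is a $C^2$-diffeomorphism, $\Phi_0=\mathrm{id}$ and $\frac{d}{dt}\Phi_t(p)=\mathbf V(t,\Phi_t(p))$ on $[0,T]$ for a velocity field $\mathbf V\in C^0([0,T];C^2(\mathbb R^3;\mathbb R^3))$ with tangential part $\mathbf V_\tau$. Let $\mathbf V_a$ be a measurable, essentially bounded vector field tangential to $\Gamma(t)$, let $0<\theta<1$ and $$F(r)=\tfrac{\theta}{2}\big((1+r)\log(1+r)+(1-r)\log(1-r)\big)+\tfrac{1-r^2}{2}.$$ For $X=L^2,H^1,H^{-1}$, write $L^2_{X}$ for the space of families $t\mapsto u(t)\in X(\Gamma(t))$ whose pull-back to $\Gamma_0$ along $\Phi_t$ belongs to $L^2(0,T;X(\Gamma_0))$. The weak material derivative of $u\in L^2_{H^1}$ is the $\partial^\bullet u\in L^2_{H^{-1}}$,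 if it exists, such that $$\int_0^T\langle\partial^\bullet u,\eta\rangle\,dt=-\int_0^T\!\!\int_{\Gamma(t)}u\,\partial^\bullet\eta\,dt-\int_0^T\!\!\int_{\Gamma(t)}u\,\eta\,\nabla_\Gamma\!\cdot\mathbf V\,dt$$ for all $\eta$ with $\eta(t)\circ\Phi_t=\zeta(t)$, $\zeta\in C_c^\infty((0,T);H^1(\Gamma_0))$, where $\partial^\bullet\eta(t)\circ\Phi_t=\zeta'(t)$. Let $u_0\in H^1(\Gamma_0)$ with $|u_0|\le1$ a.e., and put $$m_{u_0}(t)=\frac1{|\Gamma(t)|}\Big|\int_{\Gamma_0}u_0\Big|,\qquad t\in[0,T].$$ Suppose that either (i) there is a subset of $[0,T]$ of positive (outer) measure on which $m_{u_0}\ge1$, or (ii) $m_{u_0}(t)>1$ for some $t\in[0,T]$. Then there is no pair $(u,w)$ such that $u,w\in L^2_{H^1}$, $\partial^\bullet u$ exists in $L^2_{H^{-1}}$, for a.e. $t\in[0,T]$ one has $|u(t)|<1$ a.e. on $\Gamma(t)$, $u(0)=u_0$ (in the sense of the representative of $u$ for which $t\mapsto u(t)\circ\Phi_t$ is continuous from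 $[0,T]$ into $L^2(\Gamma_0)$), and, for every $\eta\in L^2_{H^1}$ and a.e. $t\in[0,T]$, $$\langle\partial^\bullet u,\eta\rangle+\int_{\Gamma(t)}u\,\eta\,\nabla_\Gamma\!\cdot\mathbf V+\int_{\Gamma(t)}u\,(\mathbf V_\tau-\mathbf V_a)\cdot\nabla_\Gamma\eta+\int_{\Gamma(t)}\nabla_\Gamma w\cdot\nabla_\Gamma\eta=0,$$ $$\int_{\Gamma(t)}\nabla_\Gamma u\cdot\nabla_\Gamma\eta+\int_{\Gamma(t)}F'(u)\,\eta-\int_{\Gamma(t)}w\,\eta=0,$$ where $F'(u)\eta$ is integrable on $\Gamma(t)$. In particular, the logarithmic Cahn–Hilliard system has no weak solution with initial value $u_0$ (for which, moreover, $u\in L^\infty_{H^1}$ is required). -/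

import Mathlib

open MeasureTheory Set
open scoped ContDiff

noncomputable section

namespace EvolvingCH

/-- The ambient space `ℝ³` with its Euclidean structure. -/
abbrev E3 : Type := EuclideanSpace ℝ (Fin 3)

/-! ### Surfaces in `ℝ³` -/

/-- `S` is a closed (compact, without boundary), connected, regular `C²`-surface in `ℝ³`: near each
of its points it is a regular level set of a `C²` function. (A compact surface embedded in `ℝ³` is
automatically orientable.) -/
structure IsClosedC2Surface (S : Set E3) : Prop where
  isCompact : IsCompact S
  isConnected : IsConnected S
  regular : ∀ x ∈ S, ∃ (U : Set E3) (f : E3 → ℝ), IsOpen U ∧ x ∈ U ∧ ContDiffOn ℝ 2 f U ∧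
    (∀ y ∈ U, fderiv ℝ f y ≠ 0) ∧ S ∩ U = {y ∈ U | f y = 0}

/-- The surface measure of `S`: the two-dimensional Hausdorff measure (normalised so that it agrees
with Lebesgue measure on planes), restricted to `S`. -/
def surfaceMeasure (S : Set E3) : Measure E3 :=
  (Measure.euclideanHausdorffMeasure 2).restrict S

/-- The area `|S|`. -/
def area (S : Set E3) : ℝ := (surfaceMeasure S).real univ

/-- The tangent space `T_x S` (for a regular surface the tangent cone already is the tangent
plane). -/
def tangentPlane (S : Set E3) (x : E3) : Submodule ℝ E3 :=
  Submodule.span ℝ (tangentConeAt ℝ S x)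

/-- The orthogonal projection of `ℝ³` onto `T_x S`. -/
def tangentProj (S : Set E3) (x : E3) : E3 →L[ℝ] E3 :=
  (tangentPlane S x).starProjection

/-- The tangential gradient on `S` of a function given in the ambient space. -/
def tangentGrad (S : Set E3) (φ : E3 → ℝ) (x : E3) : E3 :=
  tangentProj S x (gradient φ x)

/-- The surface divergence `∇_S · X = tr (P DX)` of a (not necessarily tangential) vector field. -/
def surfaceDiv (S : Set E3) (X : E3 → E3) (x : E3) : ℝ :=
  LinearMap.trace ℝ E3 ((tangentProj S x ∘L fderiv ℝ X x : E3 →L[ℝ] E3) : E3 →ₗ[ℝ] E3)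

/-! ### The space `H¹(S)` and its dual -/

/-- The Hilbert space `L²(S) × L²(S; ℝ³)`, with norm `(‖u‖² + ‖g‖²)^{1/2}`. -/
abbrev L2Pair (S : Set E3) : Type :=
  WithLp 2 (Lp ℝ 2 (surfaceMeasure S) × Lp E3 2 (surfaceMeasure S))

/-- The pairs `(φ, ∇_S φ)`, where `φ` is (the restriction to `S` of) a `C¹` function. -/
def gradGraph (S : Set E3) : Submodule ℝ (L2Pair S) where
  carrier := {p | ∃ φ : E3 → ℝ, ContDiff ℝ 1 φ ∧ p.fst =ᵐ[surfaceMeasure S] φ ∧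
    p.snd =ᵐ[surfaceMeasure S] tangentGrad S φ}
  zero_mem' := by
    refine ⟨fun _ => 0, contDiff_const, Lp.coeFn_zero _ _ _, ?_⟩
    filter_upwards [Lp.coeFn_zero E3 2 (surfaceMeasure S)] with x hx
    simpa [tangentGrad, gradient] using hx
  add_mem' := by
    rintro p q ⟨φ, hφ, hp, hp'⟩ ⟨ψ, hψ, hq, hq'⟩
    refine ⟨fun x => φ x + ψ x, hφ.add hψ, ?_, ?_⟩
    · filter_upwards [hp, hq, Lp.coeFn_add p.fst q.fst] with x h1 h2 h3
      simpa [h1, h2] using h3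
    · filter_upwards [hp', hq', Lp.coeFn_add p.snd q.snd] with x h1 h2 h3
      have e : gradient (fun y => φ y + ψ y) x = gradient φ x + gradient ψ x := by
        simp only [gradient]
        rw [fderiv_fun_add (hφ.differentiable one_ne_zero x) (hψ.differentiable one_ne_zero x),
          map_add]
      simp only [tangentGrad] at h1 h2 ⊢
      rw [e, map_add, ← h1, ← h2]
      simpa using h3
  smul_mem' := by
    rintro c p ⟨φ, hφ, hp, hp'⟩
    refine ⟨fun x => c * φ x, contDiff_const.mul hφ, ?_, ?_⟩
    · filter_upwards [hp, Lp.coeFn_smul c p.fst] with x h1 h3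
      simpa [h1] using h3
    · filter_upwards [hp', Lp.coeFn_smul c p.snd] with x h1 h3
      have e : gradient (fun y => c * φ y) x = c • gradient φ x := by
        simp only [gradient]
        rw [fderiv_const_mul (hφ.differentiable one_ne_zero x), map_smul]
      simp only [tangentGrad] at h1 ⊢
      rw [e, map_smul, ← h1]
      simpa using h3

/-- The Hilbert space `H¹(S)`: the completion of `C¹(S)` for the norm
`(‖φ‖² + ‖∇_S φ‖²)^{1/2}`, realised as the closure of `{(φ, ∇_S φ)}` in `L²(S) × L²(S; ℝ³)`. -/
abbrev H1 (S : Set E3) : Type := ↥(gradGraph S).topologicalClosure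

/-- The function underlying an element of `H¹(S)`. -/
def H1.fn {S : Set E3} (u : H1 S) : E3 → ℝ := ⇑(u.1.fst)

/-- The weak tangential gradient of an element of `H¹(S)`. -/
def H1.grad {S : Set E3} (u : H1 S) : E3 → E3 := ⇑(u.1.snd)

/-- The dual space `H⁻¹(S)` of `H¹(S)`. -/
abbrev Hm1 (S : Set E3) : Type := StrongDual ℝ (H1 S)

/-! ### Evolving surfaces -/

/-- A `C²`-evolving surface over `[0,T]`: an initial surface `Γ₀`, a flow map `Φ` and a velocity
field `V ∈ C⁰([0,T]; C²(ℝ³; ℝ³))` whose flow is `Φ`. Times outside `[0,T]` play no role. -/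
structure EvolvingSurface (T : ℝ) where
  /-- the initial surface -/
  Γ₀ : Set E3
  /-- the flow map `(t, p) ↦ Φ_t^0 p` -/
  Φ : ℝ → E3 → E3
  /-- the velocity field -/
  V : ℝ → E3 → E3
  surface₀ : IsClosedC2Surface Γ₀
  flow_contDiffOn : ∀ t ∈ Icc 0 T, ContDiffOn ℝ 2 (Φ t) Γ₀
  flow_inv : ∀ t ∈ Icc 0 T, ∃ Ψ : E3 → E3, ContDiffOn ℝ 2 Ψ (Φ t '' Γ₀) ∧ LeftInvOn Ψ (Φ t) Γ₀
  flow_zero : ∀ p ∈ Γ₀, Φ 0 p = p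
  flow_deriv : ∀ p ∈ Γ₀, ∀ t ∈ Icc 0 T,
    HasDerivWithinAt (fun s => Φ s p) (V t (Φ t p)) (Icc 0 T) t
  velocity_contDiff : ∀ t ∈ Icc 0 T, ContDiff ℝ 2 (V t)
  velocity_continuousOn : ∀ k : ℕ, k ≤ 2 →
    ContinuousOn (fun q : ℝ × E3 => iteratedFDeriv ℝ k (V q.1) q.2) (Icc 0 T ×ˢ univ)

namespace EvolvingSurface

variable {T : ℝ} (G : EvolvingSurface T)

/-- The surface `Γ(t)`. -/
def Γ (t : ℝ) : Set E3 := G.Φ t '' G.Γ₀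

/-- `z₀ = φ_{-t} z`, i.e. `z₀ = z ∘ Φ_t^0` almost everywhere on `Γ₀`; equivalently `z = φ_t z₀`. -/
def IsPullback (t : ℝ) (z : H1 (G.Γ t)) (z₀ : H1 G.Γ₀) : Prop :=
  z₀.fn =ᵐ[surfaceMeasure G.Γ₀] fun p => z.fn (G.Φ t p)

/-- Membership in `L²_{H¹}`: `t ↦ φ_{-t} u(t)` belongs to `L²(0,T; H¹(Γ₀))`. -/
def MemL2H1 (u : ∀ t, H1 (G.Γ t)) : Prop :=
  ∃ U : ℝ → H1 G.Γ₀, MemLp U 2 (volume.restrict (Icc 0 T)) ∧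
    ∀ᵐ t ∂volume.restrict (Icc 0 T), G.IsPullback t (u t) (U t)

/-- Membership in `L²_{H⁻¹} = (L²_{H¹})*`: `v(t)` is the push-forward of some `W(t)`, that is,
`⟨v(t), z⟩ = ⟨W(t), φ_{-t} z⟩`, where `W ∈ L²(0,T; H⁻¹(Γ₀))`. -/
def MemL2Hm1 (v : ∀ t, Hm1 (G.Γ t)) : Prop :=
  ∃ W : ℝ → Hm1 G.Γ₀, MemLp W 2 (volume.restrict (Icc 0 T)) ∧
    ∀ᵐ t ∂volume.restrict (Icc 0 T), ∀ (z : H1 (G.Γ t)) (z₀ : H1 G.Γ₀),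
      G.IsPullback t z z₀ → v t z = W t z₀

/-- `v` is the weak material derivative `∂•u` of `u`. The test functions are the
`η ∈ 𝒟_{H¹}(0,T)`, that is `η(t) = φ_t ζ(t)` with `ζ ∈ C_c^∞((0,T); H¹(Γ₀))`; their strong material
derivative is `∂•η(t) = φ_t ζ'(t)`, denoted `dη` below. -/
def IsWeakMaterialDeriv (u : ∀ t, H1 (G.Γ t)) (v : ∀ t, Hm1 (G.Γ t)) : Prop :=
  ∀ ζ : ℝ → H1 G.Γ₀, ContDiff ℝ ∞ ζ → HasCompactSupport ζ → tsupport ζ ⊆ Ioo 0 T →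
    ∀ η dη : ∀ t, H1 (G.Γ t),
      (∀ t ∈ Icc 0 T, G.IsPullback t (η t) (ζ t)) →
      (∀ t ∈ Icc 0 T, G.IsPullback t (dη t) (deriv ζ t)) →
      ∫ t in Icc 0 T, v t (η t) =
        - (∫ t in Icc 0 T, ∫ x, (u t).fn x * (dη t).fn x ∂surfaceMeasure (G.Γ t))
        - ∫ t in Icc 0 T, ∫ x, (u t).fn x * (η t).fn x * surfaceDiv (G.Γ t) (G.V t) x
            ∂surfaceMeasure (G.Γ t)

/-- `u(0) = u₀`: the representative of `u` in `C⁰_{L²}` (that is, with `t ↦ φ_{-t} u(t)` continuous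
from `[0,T]` to `L²(Γ₀)`) takes the value `u₀` at `t = 0`. -/
def HasInitialValue (u : ∀ t, H1 (G.Γ t)) (u₀ : H1 G.Γ₀) : Prop :=
  ∃ U : ℝ → Lp ℝ 2 (surfaceMeasure G.Γ₀), ContinuousOn U (Icc 0 T) ∧
    (∀ᵐ t ∂volume.restrict (Icc 0 T),
      U t =ᵐ[surfaceMeasure G.Γ₀] fun p => (u t).fn (G.Φ t p)) ∧
    U 0 =ᵐ[surfaceMeasure G.Γ₀] u₀.fn

/-- An admissible advective velocity: a tangential, measurable, essentially bounded field `V_a` on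
the evolving surface. -/
structure IsAdvectiveVelocity (Va : ℝ → E3 → E3) : Prop where
  measurable : AEStronglyMeasurable (fun q : ℝ × E3 => Va q.1 (G.Φ q.1 q.2))
    ((volume.restrict (Icc 0 T)).prod (surfaceMeasure G.Γ₀))
  tangential : ∀ᵐ t ∂volume.restrict (Icc 0 T), ∀ᵐ x ∂surfaceMeasure (G.Γ t),
    Va t x ∈ tangentPlane (G.Γ t) x
  bounded : ∃ C : ℝ, ∀ᵐ t ∂volume.restrict (Icc 0 T), ∀ᵐ x ∂surfaceMeasure (G.Γ t),
    ‖Va t x‖ ≤ C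

/-! ### The forms of the weak formulation -/

/-- `m(t; η, φ) = ∫_{Γ(t)} η φ`. -/
def formM (t : ℝ) (η φ : E3 → ℝ) : ℝ :=
  ∫ x, η x * φ x ∂surfaceMeasure (G.Γ t)

/-- `g(t; η, φ) = ∫_{Γ(t)} η φ ∇_{Γ(t)} · V(t)`. -/
def formG (t : ℝ) (η φ : E3 → ℝ) : ℝ :=
  ∫ x, η x * φ x * surfaceDiv (G.Γ t) (G.V t) x ∂surfaceMeasure (G.Γ t)

/-- `a_N(t; η, φ) = ∫_{Γ(t)} η (V_τ - V_a) · ∇_{Γ(t)} φ`, where `V_τ` is the tangential part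
of `V`. -/
def formAN (Va : ℝ → E3 → E3) (t : ℝ) (η : E3 → ℝ) (φ : H1 (G.Γ t)) : ℝ :=
  ∫ x, η x * inner ℝ (tangentProj (G.Γ t) x (G.V t x) - Va t x) (φ.grad x)
    ∂surfaceMeasure (G.Γ t)

/-- `a_S(t; η, φ) = ∫_{Γ(t)} ∇_{Γ(t)} η · ∇_{Γ(t)} φ`. -/
def formAS (t : ℝ) (η φ : H1 (G.Γ t)) : ℝ :=
  ∫ x, inner ℝ (η.grad x) (φ.grad x) ∂surfaceMeasure (G.Γ t)

end EvolvingSurface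

/-! ### The Cahn–Hilliard system with the logarithmic potential -/

/-- The logarithmic potential at temperature `θ` (with critical temperature `1`), relevant
for `-1 ≤ r ≤ 1`. -/
def logPotential (θ r : ℝ) : ℝ :=
  θ / 2 * ((1 + r) * Real.log (1 + r) + (1 - r) * Real.log (1 - r)) + (1 - r ^ 2) / 2

namespace EvolvingSurface

variable {T : ℝ} (G : EvolvingSurface T)

/-- `(u, w)` is a weak solution of the logarithmic Cahn–Hilliard system with initial value `u₀` and
`|u| < 1` almost everywhere: `u ∈ H¹_{H⁻¹}`, `w ∈ L²_{H¹}`, and both equations hold. -/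
structure IsLogCHSolution (θ : ℝ) (Va : ℝ → E3 → E3) (u₀ : H1 G.Γ₀)
    (u w : ∀ t, H1 (G.Γ t)) : Prop where
  memL2H1_u : G.MemL2H1 u
  memL2H1_w : G.MemL2H1 w
  abs_lt_one : ∀ᵐ t ∂volume.restrict (Icc 0 T), ∀ᵐ x ∂surfaceMeasure (G.Γ t), |(u t).fn x| < 1
  /-- `u` has a weak material derivative `v = ∂•u ∈ L²_{H⁻¹}`, and
  `⟨∂•u, η⟩ + g(u, η) + a_N(u, η) + a_S(w, η) = 0` -/
  first_eq : ∃ v : ∀ t, Hm1 (G.Γ t), G.MemL2Hm1 v ∧ G.IsWeakMaterialDeriv u v ∧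
    ∀ η : ∀ t, H1 (G.Γ t), G.MemL2H1 η → ∀ᵐ t ∂volume.restrict (Icc 0 T),
      v t (η t) + G.formG t (u t).fn (η t).fn + G.formAN Va t (u t).fn (η t)
        + G.formAS t (w t) (η t) = 0
  /-- `a_S(u, η) + m(F'(u), η) - m(w, η) = 0`, where the middle integral exists -/
  second_eq : ∀ η : ∀ t, H1 (G.Γ t), G.MemL2H1 η → ∀ᵐ t ∂volume.restrict (Icc 0 T),
    Integrable (fun x => deriv (logPotential θ) ((u t).fn x) * (η t).fn x)
      (surfaceMeasure (G.Γ t)) ∧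
    G.formAS t (u t) (η t) + G.formM t (fun x => deriv (logPotential θ) ((u t).fn x)) (η t).fn
      - G.formM t (w t).fn (η t).fn = 0
  initial : G.HasInitialValue u u₀

/-- `m_{u₀}(t) = |∫_{Γ₀} u₀| / |Γ(t)|`. -/
def massRatio (u₀ : H1 G.Γ₀) (t : ℝ) : ℝ :=
  |∫ p, u₀.fn p ∂surfaceMeasure G.Γ₀| / area (G.Γ t)

end EvolvingSurface

end EvolvingCH

end

namespace EvolvingCH

/-! The proof is conservation of mass. For the test function `1` both gradient terms of the first
equation vanish, so `⟨∂•u, 1⟩` cancels the divergence term. Inserting `φ(t) · 1` into the definition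
of `∂•u` then gives `∫ φ' M = 0` for every scalar test function `φ`, where `M(t) = ∫_{Γ(t)} u`.
Since `M` agrees a.e. with a continuous function whose value at `0` is `∫ u₀`, the du Bois-Reymond
lemma yields `M = ∫ u₀` for a.e. `t` (`IsLogCHSolution.integral_eq`). But `|u| < 1` forces `|M(t)| <
|Γ(t)|` when the area is nonzero, hence `m_{u₀} < 1` for a.e. `t`. This contradicts (i) at once, and
(ii) because `|Γ(t)|` is continuous.

The geometric input is the finiteness of the areas, which puts constants into `H¹`, and the
continuity of `|Γ(t)|` and `M`. No transport formula or Jacobian is needed: by Grönwall the flow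
from time `s` to time `t` is Lipschitz with constant `exp (K |t - s|)`, so two-dimensional Hausdorff
measures change at most by the square of that factor (`exists_pullMeasure_le`). -/

open scoped NNReal ENNReal Topology

/-! ### Hausdorff area: comparison under Lipschitz maps, finiteness on closed surfaces -/

/-- If `f` separates points of `A` at most `K` times as much as `g` does, then the area of `f '' A`
is at most `K ^ 2` times that of `g '' A`. -/
lemma euclideanHausdorffMeasure_image_le {ι X Y : Type*} [Nonempty ι]
    [MetricSpace X] [MeasurableSpace X] [BorelSpace X]
    [MetricSpace Y] [MeasurableSpace Y] [BorelSpace Y] {f : ι → X} {g : ι → Y} {A : Set ι} {K : ℝ≥0}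
    (h : ∀ x ∈ A, ∀ y ∈ A, edist (f x) (f y) ≤ K * edist (g x) (g y)) :
    μHE[2] (f '' A) ≤ (K : ℝ≥0∞) ^ 2 * μHE[2] (g '' A) := by
  have hmem : ∀ z ∈ g '' A, Function.invFunOn g A z ∈ A := fun z hz => Function.invFunOn_mem hz
  have heq : ∀ z ∈ g '' A, g (Function.invFunOn g A z) = z := fun z hz => Function.invFunOn_eq hz
  have hL : LipschitzOnWith K (f ∘ Function.invFunOn g A) (g '' A) := by
    intro y hy z hz
    have := h _ (hmem y hy) _ (hmem z hz)
    rwa [heq y hy, heq z hz] at this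
  -- The chosen preimage of `g x` need not be `x`, but by `h` points with equal `g` have equal `f`.
  have himg : (f ∘ Function.invFunOn g A) '' (g '' A) = f '' A := by
    rw [← image_comp]
    refine image_congr fun x hx => ?_
    have hgx := mem_image_of_mem g hx
    have := h _ (hmem _ hgx) _ hx
    rw [heq _ hgx, edist_self, mul_zero] at this
    exact edist_le_zero.1 this
  have := hL.hausdorffMeasure_image_le (d := (2 : ℕ)) (by positivity)
  rw [himg] at this
  simp only [Measure.euclideanHausdorffMeasure_def, Measure.smul_apply, ENNReal.smul_def,
    smul_eq_mul]
  rw [mul_left_comm]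
  gcongr
  simpa using this

/-- A bounded subset of a plane has finite area. -/
lemma euclideanHausdorffMeasure_lt_top_of_subset_submodule (W : Submodule ℝ E3)
    (hW : Module.finrank ℝ W = 2) {B : Set E3} (hB : Bornology.IsBounded B) (hBW : B ⊆ W) :
    μHE[2] B < ⊤ := by
  have hB' : ((↑) : W → E3) '' (((↑) : W → E3) ⁻¹' B) = B :=
    image_preimage_eq_of_subset (by simpa using hBW)
  rw [← hB', isometry_subtype_coe.euclideanHausdorffMeasure_image, ← hW,
    InnerProductSpace.euclideanHausdorffMeasure_eq_volume]
  obtain ⟨R, hR⟩ := hB.subset_closedBall 0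
  refine (measure_mono (t := Metric.closedBall (0 : W) R) fun x hx => ?_).trans_lt
    measure_closedBall_lt_top
  simpa using hR hx

/-- The level set of a function with nonzero strict derivative has locally finite area. -/
lemma exists_nhds_euclideanHausdorffMeasure_lt_top {f : E3 → ℝ} {L : E3 →L[ℝ] ℝ} {x : E3}
    (hf : HasStrictFDerivAt f L x) (hL : L ≠ 0) :
    ∃ N ∈ 𝓝 x, μHE[2] (N ∩ {y | f y = 0}) < ⊤ := by
  obtain ⟨v, hv⟩ : ∃ v, L v = 1 := by
    obtain ⟨v, hv⟩ := DFunLike.ne_iff.1 hL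
    exact ⟨(L v)⁻¹ • v, by simpa using inv_mul_cancel₀ hv⟩
  have hv0 : v ≠ 0 := by rintro rfl; simp at hv
  have hvn : 0 < ‖v‖₊ := by simpa using hv0
  -- The constant `(2 ‖v‖)⁻¹` makes the component along `v` of a chord of the level set at most half
  -- the chord. So `P`, the projection onto `ker L` along `v`, shrinks chords at most by a factor
  -- `2`, and the area is controlled by that of a bounded planar set.
  obtain ⟨N₀, hN₀, happ⟩ := hf.approximates_deriv_on_nhds (c := (2 * ‖v‖₊)⁻¹) (Or.inr (by positivity))
  set P : E3 →L[ℝ] E3 := ContinuousLinearMap.id ℝ E3 - L.smulRight v with hP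
  have hPker : ∀ y, P y ∈ LinearMap.ker (L : E3 →ₗ[ℝ] ℝ) := by
    intro y
    simp [hP, hv]
  have hrank : Module.finrank ℝ (LinearMap.ker (L : E3 →ₗ[ℝ] ℝ)) = 2 := by
    have h1 := LinearMap.finrank_range_add_finrank_ker (L : E3 →ₗ[ℝ] ℝ)
    have h2 : LinearMap.range (L : E3 →ₗ[ℝ] ℝ) = ⊤ :=
      LinearMap.range_eq_top.2 fun r => ⟨r • v, by simp [hv]⟩
    rw [h2, finrank_top] at h1
    simp at h1
    omega
  refine ⟨N₀ ∩ Metric.ball x 1, Filter.inter_mem hN₀ (Metric.ball_mem_nhds x one_pos), ?_⟩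
  set A := N₀ ∩ Metric.ball x 1 ∩ {y | f y = 0}
  have key : ∀ y ∈ A, ∀ z ∈ A, edist (id y) (id z) ≤ (2 : ℝ≥0) * edist (P y) (P z) := by
    intro y hy z hz
    have h1 := happ y hy.1.1 z hz.1.1
    rw [show f y = 0 from hy.2, show f z = 0 from hz.2, sub_self, zero_sub, norm_neg] at h1
    have h2 : y - z = (P y - P z) + L (y - z) • v := by
      rw [← map_sub]; simp [hP]
    have h3 : ‖y - z‖ ≤ ‖P y - P z‖ + ‖L (y - z)‖ * ‖v‖ := by
      conv_lhs => rw [h2]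
      exact (norm_add_le _ _).trans_eq (by rw [norm_smul])
    have hvn' : 0 < ‖v‖ := by simpa using hv0
    have h4 : ‖L (y - z)‖ * ‖v‖ ≤ 2⁻¹ * ‖y - z‖ := by
      calc ‖L (y - z)‖ * ‖v‖ ≤ (2 * ‖v‖)⁻¹ * ‖y - z‖ * ‖v‖ := by
            gcongr
            simpa using h1
        _ = 2⁻¹ * ‖y - z‖ := by field_simp
    have h5 : dist y z ≤ 2 * dist (P y) (P z) := by
      rw [dist_eq_norm, dist_eq_norm]; linarith
    rw [id, id, edist_nndist, edist_nndist]
    exact_mod_cast h5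
  have := euclideanHausdorffMeasure_image_le key
  rw [image_id] at this
  refine this.trans_lt (ENNReal.mul_lt_top (by simp) ?_)
  refine euclideanHausdorffMeasure_lt_top_of_subset_submodule _ hrank ?_
    (image_subset_iff.2 fun y _ => hPker y)
  refine (P.lipschitz.isBounded_image ((Metric.isBounded_ball (x := x) (r := 1)).subset ?_))
  exact fun y hy => hy.1.2

/-- Compactness reduces this to local finiteness, which holds for regular level sets. -/
lemma IsClosedC2Surface.measure_lt_top {S : Set E3} (hS : IsClosedC2Surface S) :
    μHE[2] S < ⊤ := by
  refine hS.isCompact.measure_lt_top_of_nhdsWithin fun x hx => ?_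
  obtain ⟨U, f, hU, hxU, hf, hdf, hSU⟩ := hS.regular x hx
  have hfx : HasStrictFDerivAt f (fderiv ℝ f x) x :=
    (hf.contDiffAt (hU.mem_nhds hxU)).hasStrictFDerivAt (by norm_num)
  obtain ⟨N, hN, hfin⟩ := exists_nhds_euclideanHausdorffMeasure_lt_top hfx (hdf x hxU)
  refine ⟨S ∩ (U ∩ N), Filter.inter_mem self_mem_nhdsWithin
    (mem_nhdsWithin_of_mem_nhds (Filter.inter_mem (hU.mem_nhds hxU) hN)),
    (measure_mono ?_).trans_lt hfin⟩
  rintro y ⟨hyS, hyU, hyN⟩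
  have : y ∈ S ∩ U := ⟨hyS, hyU⟩
  rw [hSU] at this
  exact ⟨hyN, this.2⟩

/-! ### Grönwall estimates forward and backward in time -/

section Gronwall

variable {E : Type*} [NormedAddCommGroup E] [NormedSpace ℝ E] {v : ℝ → E → E} {s : Set E} {K : ℝ≥0}
  {f g : ℝ → E} {a b : ℝ}

lemma dist_le_of_trajectories_Icc (hab : a ≤ b) (hv : ∀ t ∈ Icc a b, LipschitzOnWith K (v t) s)
    (hf : ∀ t ∈ Icc a b, HasDerivWithinAt f (v t (f t)) (Icc a b) t)
    (hg : ∀ t ∈ Icc a b, HasDerivWithinAt g (v t (g t)) (Icc a b) t)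
    (hfs : ∀ t ∈ Icc a b, f t ∈ s) (hgs : ∀ t ∈ Icc a b, g t ∈ s) :
    dist (f b) (g b) ≤ dist (f a) (g a) * Real.exp (K * (b - a)) := by
  refine dist_le_of_trajectories_ODE_of_mem (v := v) (s := fun _ => s)
    (fun t ht => hv t (Ico_subset_Icc_self ht)) (fun t ht => (hf t ht).continuousWithinAt)
    (fun t ht => ?_) (fun t ht => hfs t (Ico_subset_Icc_self ht))
    (fun t ht => (hg t ht).continuousWithinAt) (fun t ht => ?_)
    (fun t ht => hgs t (Ico_subset_Icc_self ht)) le_rfl b (right_mem_Icc.2 hab)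
  · exact (hf t (Ico_subset_Icc_self ht)).mono_of_mem_nhdsWithin (Icc_mem_nhdsGE_of_mem ht)
  · exact (hg t (Ico_subset_Icc_self ht)).mono_of_mem_nhdsWithin (Icc_mem_nhdsGE_of_mem ht)

lemma hasDerivWithinAt_comp_reflect {w : E} {t : ℝ}
    (hf : HasDerivWithinAt f w (Icc a b) (a + b - t)) :
    HasDerivWithinAt (fun t => f (a + b - t)) (-w) (Icc a b) t := by
  have h1 : HasDerivWithinAt (fun t : ℝ => a + b - t) (-1) (Icc a b) t :=
    ((hasDerivAt_id t).const_sub (a + b)).hasDerivWithinAt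
  have := HasDerivWithinAt.scomp t hf h1 fun x hx => ⟨by linarith [hx.2], by linarith [hx.1]⟩
  simpa [Function.comp_def] using this

/-- The reflection `t ↦ a + b - t` turns `v` into `-v` with the same Lipschitz constant, so the
forward estimate applies. -/
lemma dist_le_of_trajectories_Icc_backward (hab : a ≤ b)
    (hv : ∀ t ∈ Icc a b, LipschitzOnWith K (v t) s)
    (hf : ∀ t ∈ Icc a b, HasDerivWithinAt f (v t (f t)) (Icc a b) t)
    (hg : ∀ t ∈ Icc a b, HasDerivWithinAt g (v t (g t)) (Icc a b) t)
    (hfs : ∀ t ∈ Icc a b, f t ∈ s) (hgs : ∀ t ∈ Icc a b, g t ∈ s) :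
    dist (f a) (g a) ≤ dist (f b) (g b) * Real.exp (K * (b - a)) := by
  have hr : ∀ t ∈ Icc a b, a + b - t ∈ Icc a b :=
    fun t ht => ⟨by linarith [ht.2], by linarith [ht.1]⟩
  have := dist_le_of_trajectories_Icc (v := fun t x => -(v (a + b - t) x)) (s := s) (K := K)
    (f := fun t => f (a + b - t)) (g := fun t => g (a + b - t)) hab
    (fun t ht => (hv _ (hr t ht)).neg)
    (fun t ht => hasDerivWithinAt_comp_reflect (hf _ (hr t ht)))
    (fun t ht => hasDerivWithinAt_comp_reflect (hg _ (hr t ht)))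
    (fun t ht => hfs _ (hr t ht)) (fun t ht => hgs _ (hr t ht))
  simpa using this

end Gronwall

/-! ### Lipschitz bounds for the flow -/

namespace EvolvingSurface

variable {T : ℝ} (G : EvolvingSurface T)

/-- The first derivative of the velocity is bounded on the compact set `[0,T] × closedBall 0 R`, and
the ball is convex. The bound is only local in space, so trajectories must first be confined to one
ball. -/
lemma exists_lipschitzOnWith_velocity (R : ℝ) :
    ∃ K : ℝ≥0, ∀ t ∈ Icc 0 T, LipschitzOnWith K (G.V t) (Metric.closedBall 0 R) := by
  obtain ⟨C, hC⟩ := ((isCompact_Icc (a := (0 : ℝ)) (b := T)).prod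
    (isCompact_closedBall (0 : E3) R)).exists_bound_of_continuousOn
    ((G.velocity_continuousOn 1 (by norm_num)).mono (prod_mono_right (subset_univ _)))
  refine ⟨C.toNNReal, fun t ht => (convex_closedBall 0 R).lipschitzOnWith_of_nnnorm_fderiv_le
    (𝕜 := ℝ) (fun x _ => (G.velocity_contDiff t ht).differentiable (by norm_num) x)
    fun x hx => ?_⟩
  have := hC (t, x) ⟨ht, hx⟩
  rw [norm_iteratedFDeriv_one] at this
  rw [← NNReal.coe_le_coe]
  exact this.trans (Real.le_coe_toNNReal C)

lemma continuousOn_flow {p : E3} (hp : p ∈ G.Γ₀) : ContinuousOn (fun t => G.Φ t p) (Icc 0 T) :=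
  fun t ht => (G.flow_deriv p hp t ht).continuousWithinAt

lemma flow_deriv_Icc {p : E3} (hp : p ∈ G.Γ₀) {a b : ℝ} (ha : 0 ≤ a) (hb : b ≤ T) :
    ∀ t ∈ Icc a b, HasDerivWithinAt (fun s => G.Φ s p) (G.V t (G.Φ t p)) (Icc a b) t :=
  fun t ht => (G.flow_deriv p hp t ⟨ha.trans ht.1, ht.2.trans hb⟩).mono (Icc_subset_Icc ha hb)

/-- Trajectories starting close to a given one stay close to it. -/
lemma exists_nhds_dist_flow_lt_one {p : E3} (hp : p ∈ G.Γ₀) :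
    ∃ r > 0, ∀ q ∈ G.Γ₀, dist q p < r → ∀ t ∈ Icc 0 T, dist (G.Φ t p) (G.Φ t q) < 1 := by
  rcases lt_or_ge T 0 with hT | hT
  · exact ⟨1, one_pos, fun q _ _ t ht => absurd (ht.1.trans ht.2) (not_le.2 hT)⟩
  obtain ⟨R, hR⟩ := isCompact_Icc.exists_bound_of_continuousOn (G.continuousOn_flow hp)
  -- Radius `R + 1` contains every trajectory at distance less than `1` from that of `p`; initial
  -- distance below `exp (-K T)` keeps the Grönwall bound below `1` up to time `T`.
  obtain ⟨K, hK⟩ := G.exists_lipschitzOnWith_velocity (R + 1)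
  refine ⟨Real.exp (-(K * T)), Real.exp_pos _, fun q hq hqp => ?_⟩
  set D : ℝ → ℝ := fun t => dist (G.Φ t p) (G.Φ t q)
  have hD : ContinuousOn D (Icc 0 T) :=
    fun t ht => Filter.Tendsto.dist (G.continuousOn_flow hp t ht) (G.continuousOn_flow hq t ht)
  have hDpq : D 0 = dist q p := by
    simp only [D, G.flow_zero p hp, G.flow_zero q hq, dist_comm]
  have hlt : ∀ t ≤ T, D 0 * Real.exp (K * t) < 1 := by
    intro t ht
    calc D 0 * Real.exp (K * t) < Real.exp (-(K * T)) * Real.exp (K * t) := by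
          rw [hDpq]; gcongr
      _ = Real.exp (K * t - K * T) := by rw [← Real.exp_add]; ring_nf
      _ ≤ 1 := by
          rw [Real.exp_le_one_iff, ← mul_sub]
          exact mul_nonpos_of_nonneg_of_nonpos K.2 (by linarith)
  have hcl : IsClosed ({t | D t ≤ D 0 * Real.exp (K * t)} ∩ Icc 0 T) := by
    have : ContinuousOn (fun t => D t - D 0 * Real.exp (K * t)) (Icc 0 T) :=
      hD.sub (by fun_prop)
    have h := this.preimage_isClosed_of_isClosed isClosed_Icc (isClosed_Iic (a := (0 : ℝ)))
    convert h using 1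
    ext t
    simp [and_comm]
  -- Continuous induction: the Grönwall bound at `x` gives `D x < 1`, hence `D < 1` slightly beyond
  -- `x` by continuity, so both trajectories remain in the ball and the bound extends.
  have key : Icc 0 T ⊆ {t | D t ≤ D 0 * Real.exp (K * t)} := by
    refine hcl.Icc_subset_of_forall_exists_gt (by simp) ?_
    rintro x ⟨hx, hx0, hxT⟩ y hy
    have hxI : x ∈ Icc 0 T := ⟨hx0, hxT.le⟩
    have hDx : D x < 1 := lt_of_le_of_lt hx (hlt x hxT.le)
    have h1 : ∀ᶠ t in 𝓝[≥] x, D t < 1 :=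
      ((hD x hxI).mono_of_mem_nhdsWithin (Icc_mem_nhdsGE_of_mem ⟨hx0, hxT⟩)).eventually_lt_const hDx
    obtain ⟨z, hz, hzD⟩ := mem_nhdsGE_iff_exists_Icc_subset.1 h1
    set z' := min z (min y T)
    have hxz : x < z' := lt_min hz (lt_min hy hxT)
    have hzT : z' ≤ T := (min_le_right _ _).trans (min_le_right _ _)
    have hball : ∀ t ∈ Icc x z', t ∈ Icc 0 T := fun t ht => ⟨hx0.trans ht.1, ht.2.trans hzT⟩
    refine ⟨z', ?_, hxz, (min_le_right _ _).trans (min_le_left _ _)⟩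
    have hgr := dist_le_of_trajectories_Icc (v := G.V) (K := K) (s := Metric.closedBall 0 (R + 1))
      hxz.le (fun t ht => hK t (hball t ht)) (G.flow_deriv_Icc hp hx0 hzT)
      (G.flow_deriv_Icc hq hx0 hzT)
      (fun t ht => by
        have := hR t (hball t ht)
        simp only [Metric.mem_closedBall, dist_zero_right]; linarith)
      (fun t ht => by
        have h1 := hR t (hball t ht)
        have h2 : D t < 1 := hzD ⟨ht.1, ht.2.trans (min_le_left _ _)⟩
        have h3 := norm_le_norm_add_norm_sub' (G.Φ t q) (G.Φ t p)
        have h4 : D t = ‖G.Φ t q - G.Φ t p‖ := by simp only [D, dist_eq_norm, norm_sub_rev]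
        simp only [Metric.mem_closedBall, dist_zero_right]; linarith)
    calc D z' ≤ D x * Real.exp (K * (z' - x)) := hgr
      _ ≤ D 0 * Real.exp (K * x) * Real.exp (K * (z' - x)) := by gcongr; exact hx
      _ = D 0 * Real.exp (K * z') := by rw [mul_assoc, ← Real.exp_add]; ring_nf
  exact fun t ht => (key ht).trans_lt (hlt t ht.2)

/-- Joint continuity of the flow is not among the data, so compactness of `Γ₀` is applied to the
local stability of trajectories instead. -/
lemma exists_flow_bounded : ∃ R, ∀ p ∈ G.Γ₀, ∀ t ∈ Icc 0 T, G.Φ t p ∈ Metric.closedBall 0 R := by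
  refine G.surface₀.isCompact.induction_on
    (p := fun s => ∃ R, ∀ p ∈ s, p ∈ G.Γ₀ → ∀ t ∈ Icc 0 T, G.Φ t p ∈ Metric.closedBall 0 R)
    ⟨0, by simp⟩ (fun s t hst ⟨R, hR⟩ => ⟨R, fun p hp => hR p (hst hp)⟩) ?_ ?_ |>.imp
    fun R hR p hp => hR p hp hp
  · rintro s t ⟨R, hR⟩ ⟨R', hR'⟩
    refine ⟨max R R', fun p hp hpΓ τ hτ => ?_⟩
    rcases hp with hp | hp
    · exact Metric.closedBall_subset_closedBall (le_max_left _ _) (hR p hp hpΓ τ hτ)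
    · exact Metric.closedBall_subset_closedBall (le_max_right _ _) (hR' p hp hpΓ τ hτ)
  · intro p hp
    obtain ⟨r, hr, h⟩ := G.exists_nhds_dist_flow_lt_one hp
    obtain ⟨R, hR⟩ := isCompact_Icc.exists_bound_of_continuousOn (G.continuousOn_flow hp)
    refine ⟨Metric.ball p r, mem_nhdsWithin_of_mem_nhds (Metric.ball_mem_nhds p hr), R + 1,
      fun q hq hqΓ t ht => ?_⟩
    have h1 := hR t ht
    have h2 := h q hqΓ hq t ht
    have h3 := norm_le_norm_add_norm_sub' (G.Φ t q) (G.Φ t p)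
    rw [dist_eq_norm, norm_sub_rev] at h2
    simp only [Metric.mem_closedBall, dist_zero_right]; linarith

/-- The transition maps of the flow between the times `s` and `t` are Lipschitz with constant
`exp (K |t - s|)`. -/
lemma exists_dist_flow_le : ∃ K : ℝ≥0, ∀ s ∈ Icc 0 T, ∀ t ∈ Icc 0 T, ∀ p ∈ G.Γ₀, ∀ q ∈ G.Γ₀,
    dist (G.Φ t p) (G.Φ t q) ≤ dist (G.Φ s p) (G.Φ s q) * Real.exp (K * |t - s|) := by
  obtain ⟨R, hR⟩ := G.exists_flow_bounded
  obtain ⟨K, hK⟩ := G.exists_lipschitzOnWith_velocity R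
  refine ⟨K, fun s hs t ht p hp q hq => ?_⟩
  rcases le_total s t with hst | hst
  · have hsub : Icc s t ⊆ Icc 0 T := Icc_subset_Icc hs.1 ht.2
    rw [abs_of_nonneg (sub_nonneg.2 hst)]
    exact dist_le_of_trajectories_Icc (v := G.V) (s := Metric.closedBall 0 R)
      (f := fun τ => G.Φ τ p) (g := fun τ => G.Φ τ q) hst (fun τ hτ => hK τ (hsub hτ))
      (G.flow_deriv_Icc hp hs.1 ht.2)
      (G.flow_deriv_Icc hq hs.1 ht.2) (fun τ hτ => hR p hp τ (hsub hτ))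
      (fun τ hτ => hR q hq τ (hsub hτ))
  · have hsub : Icc t s ⊆ Icc 0 T := Icc_subset_Icc ht.1 hs.2
    rw [abs_of_nonpos (sub_nonpos.2 hst), neg_sub]
    exact dist_le_of_trajectories_Icc_backward (v := G.V) (s := Metric.closedBall 0 R)
      (f := fun τ => G.Φ τ p) (g := fun τ => G.Φ τ q) hst (fun τ hτ => hK τ (hsub hτ))
      (G.flow_deriv_Icc hp ht.1 hs.2) (G.flow_deriv_Icc hq ht.1 hs.2)
      (fun τ hτ => hR p hp τ (hsub hτ)) (fun τ hτ => hR q hq τ (hsub hτ))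

end EvolvingSurface

/-! ### Integrals against mutually comparable measures -/

section ComparableMeasures

variable {X : Type*} [MeasurableSpace X] {μ ν : Measure X} {c : ℝ} {f : X → ℝ}

lemma integral_le_mul_integral_of_le_smul (h : μ ≤ ENNReal.ofReal c • ν) (hc : 0 ≤ c)
    (hf : Integrable f ν) (h0 : ∀ x, 0 ≤ f x) : ∫ x, f x ∂μ ≤ c * ∫ x, f x ∂ν := by
  have := integral_mono_measure h (Filter.Eventually.of_forall h0)
    (hf.smul_measure ENNReal.ofReal_ne_top)
  rwa [integral_smul_measure, ENNReal.toReal_ofReal hc, smul_eq_mul] at this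

lemma integrable_of_le_smul (h : μ ≤ ENNReal.ofReal c • ν) (hf : Integrable f ν) :
    Integrable f μ :=
  (hf.smul_measure ENNReal.ofReal_ne_top).mono_measure h

/-- The upper bound is `(c - 1) ∫ f ∂ν`. The lower bound first gives `(c - 1) ∫ f ∂μ`, and returning
to `ν` costs the extra factor `c`. -/
lemma abs_integral_sub_integral_le_of_nonneg (h : μ ≤ ENNReal.ofReal c • ν)
    (h' : ν ≤ ENNReal.ofReal c • μ) (hc : 1 ≤ c) (hf : Integrable f ν) (h0 : ∀ x, 0 ≤ f x) :
    |∫ x, f x ∂μ - ∫ x, f x ∂ν| ≤ (c - 1) * c * ∫ x, f x ∂ν := by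
  have hc0 : 0 ≤ c := zero_le_one.trans hc
  have h1 := integral_le_mul_integral_of_le_smul h hc0 hf h0
  have h2 := integral_le_mul_integral_of_le_smul h' hc0 (integrable_of_le_smul h hf) h0
  have h3 : 0 ≤ ∫ x, f x ∂ν := integral_nonneg h0
  have h4 := mul_nonneg (mul_nonneg (sub_nonneg.2 hc) (sub_nonneg.2 hc)) h3
  have h5 := mul_le_mul_of_nonneg_left h1 (sub_nonneg.2 hc)
  rw [abs_le]
  constructor <;> nlinarith

lemma abs_integral_sub_integral_le (h : μ ≤ ENNReal.ofReal c • ν)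
    (h' : ν ≤ ENNReal.ofReal c • μ) (hc : 1 ≤ c) (hf : Integrable f ν) :
    |∫ x, f x ∂μ - ∫ x, f x ∂ν| ≤ (c - 1) * c * ∫ x, |f x| ∂ν := by
  have hp := abs_integral_sub_integral_le_of_nonneg h h' hc hf.pos_part fun x => le_max_right _ _
  have hn := abs_integral_sub_integral_le_of_nonneg h h' hc hf.neg_part fun x => le_max_right _ _
  have hsub : ∀ x, f x = max (f x) 0 - max (-f x) 0 := fun x =>
    (max_zero_sub_max_neg_zero_eq_self (f x)).symm
  have hadd : ∀ x, |f x| = max (f x) 0 + max (-f x) 0 := fun x =>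
    (max_zero_add_max_neg_zero_eq_abs_self (f x)).symm
  have hfμ := integrable_of_le_smul h hf
  have e1 : ∫ x, f x ∂μ = ∫ x, max (f x) 0 ∂μ - ∫ x, max (-f x) 0 ∂μ := by
    rw [← integral_sub hfμ.pos_part hfμ.neg_part]; exact integral_congr_ae (.of_forall hsub)
  have e2 : ∫ x, f x ∂ν = ∫ x, max (f x) 0 ∂ν - ∫ x, max (-f x) 0 ∂ν := by
    rw [← integral_sub hf.pos_part hf.neg_part]; exact integral_congr_ae (.of_forall hsub)
  have e3 : ∫ x, |f x| ∂ν = ∫ x, max (f x) 0 ∂ν + ∫ x, max (-f x) 0 ∂ν := by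
    rw [← integral_add hf.pos_part hf.neg_part]; exact integral_congr_ae (.of_forall hadd)
  rw [e1, e2, e3, mul_add]
  rw [abs_le] at *
  constructor <;> linarith [hp.1, hp.2, hn.1, hn.2]

/-- If the measures `ν t` are mutually comparable with constants tending to `1`, and `F` is
continuous in mean, then `t ↦ ∫ F t ∂ν t` is continuous. -/
lemma continuousOn_integral_of_comparable {ν : ℝ → Measure X} {I : Set ℝ} {k : ℝ} (hk : 0 ≤ k)
    (hν : ∀ s ∈ I, ∀ t ∈ I, ν t ≤ ENNReal.ofReal (Real.exp (k * |t - s|)) • ν s)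
    {F : ℝ → X → ℝ} {t₀ : ℝ} (ht₀ : t₀ ∈ I) (hF : ∀ t ∈ I, Integrable (F t) (ν t₀))
    (hcont : ∀ s ∈ I, Filter.Tendsto (fun t => ∫ x, |F t x - F s x| ∂ν t₀) (𝓝[I] s) (𝓝 0)) :
    ContinuousOn (fun t => ∫ x, F t x ∂ν t) I := by
  intro s hs
  have hint : ∀ t ∈ I, ∀ τ ∈ I, Integrable (F t) (ν τ) := fun t ht τ hτ =>
    integrable_of_le_smul (hν t₀ ht₀ τ hτ) (hF t ht)
  set c : ℝ → ℝ := fun t => Real.exp (k * |t - s|)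
  -- The integrand is changed first, under `ν t`, and the measure second, for the fixed integrand `F
  -- s`.
  have hbound : ∀ t ∈ I, ‖∫ x, F t x ∂ν t - ∫ x, F s x ∂ν s‖ ≤
      Real.exp (k * |t - t₀|) * ∫ x, |F t x - F s x| ∂ν t₀
        + (c t - 1) * c t * ∫ x, |F s x| ∂ν s := by
    intro t ht
    have h1 : |∫ x, F t x ∂ν t - ∫ x, F s x ∂ν t| ≤
        Real.exp (k * |t - t₀|) * ∫ x, |F t x - F s x| ∂ν t₀ := by
      rw [← integral_sub (hint t ht t ht) (hint s hs t ht)]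
      exact abs_integral_le_integral_abs.trans (integral_le_mul_integral_of_le_smul
        (hν t₀ ht₀ t ht) (Real.exp_pos _).le ((hF t ht).sub (hF s hs)).abs fun x => abs_nonneg _)
    have h2 : |∫ x, F s x ∂ν t - ∫ x, F s x ∂ν s| ≤ (c t - 1) * c t * ∫ x, |F s x| ∂ν s := by
      refine abs_integral_sub_integral_le (hν s hs t ht) ?_
        (Real.one_le_exp (by positivity)) (hint s hs s hs)
      simpa only [c, abs_sub_comm] using hν t ht s hs
    rw [Real.norm_eq_abs]
    exact (abs_sub_le _ (∫ x, F s x ∂ν t) _).trans (add_le_add h1 h2)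
  have hexp : Filter.Tendsto (fun t => Real.exp (k * |t - t₀|)) (𝓝[I] s)
      (𝓝 (Real.exp (k * |s - t₀|))) :=
    Continuous.continuousWithinAt (f := fun t => Real.exp (k * |t - t₀|)) (by fun_prop)
  have hc : Filter.Tendsto (fun t => (c t - 1) * c t * ∫ x, |F s x| ∂ν s) (𝓝[I] s) (𝓝 0) := by
    have : ContinuousWithinAt (fun t => (c t - 1) * c t * ∫ x, |F s x| ∂ν s) I s :=
      Continuous.continuousWithinAt (by fun_prop)
    simpa [ContinuousWithinAt, c] using this
  have hlim := (hexp.mul (hcont s hs)).add hc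
  rw [mul_zero, add_zero] at hlim
  refine tendsto_iff_norm_sub_tendsto_zero.2 (squeeze_zero' (.of_forall fun _ => norm_nonneg _)
    ?_ hlim)
  filter_upwards [self_mem_nhdsWithin] with t ht using hbound t ht

end ComparableMeasures

/-! ### Surface measures transported to the fixed surface `Γ₀` -/

namespace EvolvingSurface

variable {T : ℝ} (G : EvolvingSurface T)

instance : Nonempty G.Γ₀ := G.surface₀.isConnected.nonempty.to_subtype

instance : CompactSpace G.Γ₀ := isCompact_iff_compactSpace.1 G.surface₀.isCompact

/-- The flow map as a parametrisation of `Γ(t)` by `Γ₀`. -/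
def param (t : ℝ) (p : G.Γ₀) : E3 := G.Φ t p

lemma range_param (t : ℝ) : range (G.param t) = G.Γ t :=
  (image_eq_range _ _).symm

variable {t : ℝ}

/-- Comparison with time `0`, where the flow is the identity, gives continuity and injectivity;
compactness of `Γ₀` does the rest. -/
lemma measurableEmbedding_param (ht : t ∈ Icc 0 T) : MeasurableEmbedding (G.param t) := by
  obtain ⟨K, hK⟩ := G.exists_dist_flow_le
  have h0 : (0 : ℝ) ∈ Icc 0 T := ⟨le_rfl, ht.1.trans ht.2⟩
  have hcont : Continuous (G.param t) := by
    refine (LipschitzWith.of_dist_le_mul (K := (Real.exp (K * |t - 0|)).toNNReal)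
      fun p q => ?_).continuous
    have := hK 0 h0 t ht p p.2 q q.2
    rw [G.flow_zero p p.2, G.flow_zero q q.2, mul_comm] at this
    rwa [Real.coe_toNNReal _ (Real.exp_pos _).le]
  have hinj : Function.Injective (G.param t) := by
    intro p q hpq
    have := hK t ht 0 h0 p p.2 q q.2
    rw [G.flow_zero p p.2, G.flow_zero q q.2, show G.Φ t p = G.Φ t q from hpq, dist_self,
      zero_mul] at this
    exact Subtype.ext (dist_le_zero.1 this)
  exact (hcont.isClosedEmbedding hinj).measurableEmbedding

/-- The surface measure of `Γ(t)`, transported to `Γ₀`. -/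
noncomputable def pullMeasure (t : ℝ) : Measure G.Γ₀ := (μHE[2] : Measure E3).comap (G.param t)

lemma map_pullMeasure (ht : t ∈ Icc 0 T) :
    (G.pullMeasure t).map (G.param t) = surfaceMeasure (G.Γ t) := by
  rw [pullMeasure, (G.measurableEmbedding_param ht).map_comap, range_param, surfaceMeasure]

lemma integral_surfaceMeasure_eq (ht : t ∈ Icc 0 T) (f : E3 → ℝ) :
    ∫ x, f x ∂surfaceMeasure (G.Γ t) = ∫ p, f (G.param t p) ∂G.pullMeasure t := by
  rw [← G.map_pullMeasure ht, (G.measurableEmbedding_param ht).integral_map]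

lemma ae_surfaceMeasure_iff (ht : t ∈ Icc 0 T) {P : E3 → Prop} :
    (∀ᵐ x ∂surfaceMeasure (G.Γ t), P x) ↔ ∀ᵐ p ∂G.pullMeasure t, P (G.param t p) := by
  rw [← G.map_pullMeasure ht, (G.measurableEmbedding_param ht).ae_map_iff]

lemma exists_pullMeasure_le : ∃ k : ℝ, 0 ≤ k ∧ ∀ s ∈ Icc 0 T, ∀ t ∈ Icc 0 T,
    G.pullMeasure t ≤ ENNReal.ofReal (Real.exp (k * |t - s|)) • G.pullMeasure s := by
  obtain ⟨K, hK⟩ := G.exists_dist_flow_le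
  refine ⟨2 * K, by positivity, fun s hs t ht => Measure.le_iff.2 fun A _ => ?_⟩
  rw [Measure.smul_apply, pullMeasure, pullMeasure, (G.measurableEmbedding_param ht).comap_apply,
    (G.measurableEmbedding_param hs).comap_apply, smul_eq_mul]
  refine (euclideanHausdorffMeasure_image_le (g := G.param s)
    (K := (Real.exp (K * |t - s|)).toNNReal) fun p _ q _ => ?_).trans_eq ?_
  · rw [edist_nndist, edist_nndist, ← ENNReal.coe_mul, ENNReal.coe_le_coe, ← NNReal.coe_le_coe,
      NNReal.coe_mul, Real.coe_toNNReal _ (Real.exp_pos _).le, mul_comm]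
    exact hK s hs t ht p p.2 q q.2
  · rw [← ENNReal.ofReal, ← ENNReal.ofReal_pow (Real.exp_pos _).le, ← Real.exp_nat_mul]
    congr 3
    push_cast; ring

lemma param_zero (p : G.Γ₀) : G.param 0 p = p := G.flow_zero p p.2

lemma Γ_zero : G.Γ 0 = G.Γ₀ := by
  rw [Γ, image_congr G.flow_zero, image_id']

lemma map_pullMeasure_zero (hT : 0 ≤ T) :
    (G.pullMeasure 0).map ((↑) : G.Γ₀ → E3) = surfaceMeasure G.Γ₀ := by
  have := G.map_pullMeasure (t := 0) ⟨le_rfl, hT⟩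
  rwa [G.Γ_zero, show G.param 0 = ((↑) : G.Γ₀ → E3) from funext G.param_zero] at this

lemma measurableEmbedding_coe_Γ₀ : MeasurableEmbedding ((↑) : G.Γ₀ → E3) :=
  .subtype_coe G.surface₀.isCompact.measurableSet

lemma integral_surfaceMeasure_Γ₀_eq (hT : 0 ≤ T) (f : E3 → ℝ) :
    ∫ x, f x ∂surfaceMeasure G.Γ₀ = ∫ p : G.Γ₀, f p ∂G.pullMeasure 0 := by
  rw [← G.map_pullMeasure_zero hT, G.measurableEmbedding_coe_Γ₀.integral_map]

lemma ae_surfaceMeasure_Γ₀_iff (hT : 0 ≤ T) {P : E3 → Prop} :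
    (∀ᵐ x ∂surfaceMeasure G.Γ₀, P x) ↔ ∀ᵐ p : G.Γ₀ ∂G.pullMeasure 0, P p := by
  rw [← G.map_pullMeasure_zero hT, G.measurableEmbedding_coe_Γ₀.ae_map_iff]

lemma integrable_surfaceMeasure_Γ₀_iff (hT : 0 ≤ T) {f : E3 → ℝ} :
    Integrable f (surfaceMeasure G.Γ₀) ↔ Integrable (fun p : G.Γ₀ => f p) (G.pullMeasure 0) := by
  rw [← G.map_pullMeasure_zero hT, G.measurableEmbedding_coe_Γ₀.integrable_map_iff]
  rfl

lemma isFiniteMeasure_pullMeasure (ht : t ∈ Icc 0 T) : IsFiniteMeasure (G.pullMeasure t) := by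
  have h0 : (0 : ℝ) ∈ Icc 0 T := ⟨le_rfl, ht.1.trans ht.2⟩
  obtain ⟨k, -, hk⟩ := G.exists_pullMeasure_le
  refine ⟨(hk 0 h0 t ht univ).trans_lt ?_⟩
  rw [Measure.smul_apply, smul_eq_mul, pullMeasure, (G.measurableEmbedding_param h0).comap_apply,
    image_univ, range_param, Γ_zero]
  exact ENNReal.mul_lt_top ENNReal.ofReal_lt_top G.surface₀.measure_lt_top

lemma isFiniteMeasure_surfaceMeasure (ht : t ∈ Icc 0 T) :
    IsFiniteMeasure (surfaceMeasure (G.Γ t)) := by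
  have := G.isFiniteMeasure_pullMeasure ht
  rw [← G.map_pullMeasure ht]
  infer_instance

lemma area_eq (ht : t ∈ Icc 0 T) : area (G.Γ t) = ∫ _, 1 ∂G.pullMeasure t := by
  rw [← G.integral_surfaceMeasure_eq ht (fun _ => 1)]
  simp [area]

/-- Null sets on `Γ₀` correspond to null sets on `Γ(t)`. -/
lemma ae_surfaceMeasure_iff_ae_Γ₀ (ht : t ∈ Icc 0 T) {P : E3 → Prop} :
    (∀ᵐ x ∂surfaceMeasure (G.Γ t), P x) ↔ ∀ᵐ p ∂surfaceMeasure G.Γ₀, P (G.Φ t p) := by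
  have h0 : (0 : ℝ) ∈ Icc 0 T := ⟨le_rfl, ht.1.trans ht.2⟩
  obtain ⟨k, -, hk⟩ := G.exists_pullMeasure_le
  have hac : ∀ s ∈ Icc 0 T, ∀ τ ∈ Icc 0 T, G.pullMeasure τ ≪ G.pullMeasure s := fun s hs τ hτ =>
    (Measure.absolutelyContinuous_of_le (hk s hs τ hτ)).trans
      (Measure.smul_absolutelyContinuous)
  rw [G.ae_surfaceMeasure_iff ht, G.ae_surfaceMeasure_Γ₀_iff (ht.1.trans ht.2)]
  exact ⟨fun h => (hac t ht 0 h0).ae_le h, fun h => (hac 0 h0 t ht).ae_le h⟩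

lemma continuousOn_area : ContinuousOn (fun t => area (G.Γ t)) (Icc 0 T) := by
  rcases (Icc 0 T).eq_empty_or_nonempty with h | h
  · rw [h]; exact continuousOn_empty _
  obtain ⟨k, hk0, hk⟩ := G.exists_pullMeasure_le
  obtain ⟨t₀, ht₀⟩ := h
  have := G.isFiniteMeasure_pullMeasure ht₀
  refine (continuousOn_integral_of_comparable hk0 hk (F := fun _ _ => 1) ht₀
    (fun t _ => integrable_const _) (by simp [tendsto_const_nhds])).congr fun t ht => G.area_eq ht

/-- On finite measure, `L²` continuity implies `L¹` continuity by Hölder. This supplies the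
continuous version of the mass. -/
lemma continuousOn_integral_pullMeasure {U : ℝ → Lp ℝ 2 (surfaceMeasure G.Γ₀)} (hT : 0 ≤ T)
    (hU : ContinuousOn U (Icc 0 T)) :
    ContinuousOn (fun t => ∫ p : G.Γ₀, U t p ∂G.pullMeasure t) (Icc 0 T) := by
  have h0 : (0 : ℝ) ∈ Icc 0 T := ⟨le_rfl, hT⟩
  obtain ⟨k, hk0, hk⟩ := G.exists_pullMeasure_le
  have hfin := G.isFiniteMeasure_surfaceMeasure h0
  rw [G.Γ_zero] at hfin
  refine continuousOn_integral_of_comparable hk0 hk (F := fun t p => U t p) h0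
    (fun t ht => (G.integrable_surfaceMeasure_Γ₀_iff hT).1 ((Lp.memLp (U t)).integrable one_le_two))
    (fun s hs => ?_)
  have hle : ∀ t, ∫ p : G.Γ₀, |U t p - U s p| ∂G.pullMeasure 0 ≤
      ‖U t - U s‖ * (surfaceMeasure G.Γ₀).real univ ^ (1 / 2 : ℝ) := by
    intro t
    have e1 : ∫ p : G.Γ₀, |U t p - U s p| ∂G.pullMeasure 0 =
        ∫ x, ‖(U t - U s : Lp ℝ 2 (surfaceMeasure G.Γ₀)) x‖ ∂surfaceMeasure G.Γ₀ := by
      rw [← G.integral_surfaceMeasure_Γ₀_eq hT fun x => |U t x - U s x|]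
      refine integral_congr_ae ?_
      filter_upwards [Lp.coeFn_sub (U t) (U s)] with x hx
      rw [hx, Pi.sub_apply, Real.norm_eq_abs]
    have e2 := eLpNorm_le_eLpNorm_mul_rpow_measure_univ (μ := surfaceMeasure G.Γ₀)
      (p := 1) (q := 2) one_le_two (Lp.aestronglyMeasurable (U t - U s))
    rw [e1, integral_norm_eq_lintegral_enorm (Lp.aestronglyMeasurable _),
      ← eLpNorm_one_eq_lintegral_enorm, Lp.norm_def, Measure.real, ENNReal.toReal_rpow,
      ← ENNReal.toReal_mul]
    refine ENNReal.toReal_mono (ENNReal.mul_ne_top (Lp.eLpNorm_ne_top _)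
      (ENNReal.rpow_ne_top_of_nonneg (by norm_num) (measure_ne_top _ _))) (e2.trans_eq ?_)
    congr 2
    norm_num
  have hlim : Filter.Tendsto
      (fun t => ‖U t - U s‖ * (surfaceMeasure G.Γ₀).real univ ^ (1 / 2 : ℝ)) (𝓝[Icc 0 T] s)
      (𝓝 0) := by
    simpa using (tendsto_iff_norm_sub_tendsto_zero.1 (hU s hs)).mul_const
      ((surfaceMeasure G.Γ₀).real univ ^ (1 / 2 : ℝ))
  exact squeeze_zero (fun t => integral_nonneg fun _ => abs_nonneg _) hle hlim

end EvolvingSurface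

/-! ### The du Bois-Reymond lemma -/

section DuBoisReymond

variable {T : ℝ}

lemma exists_Icc_subset_Ioo_of_isCompact (hT : 0 < T) {K : Set ℝ} (hK : IsCompact K)
    (hKT : K ⊆ Ioo 0 T) : ∃ a b, 0 < a ∧ b < T ∧ K ⊆ Icc a b := by
  rcases K.eq_empty_or_nonempty with rfl | hne
  -- The interval `[T, 0]` is empty.
  · exact ⟨T, 0, hT, hT, empty_subset _⟩
  obtain ⟨a, ha⟩ := hK.exists_isLeast hne
  obtain ⟨b, hb⟩ := hK.exists_isGreatest hne
  exact ⟨a, b, (hKT ha.1).1, (hKT hb.1).2, fun x hx => ⟨ha.2 hx, hb.2 hx⟩⟩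

/-- A test function with zero mean is the derivative of a test function. -/
lemma exists_testFunction_deriv_eq (hT : 0 < T) {ψ : ℝ → ℝ} (hψ : ContDiff ℝ ∞ ψ)
    (hc : HasCompactSupport ψ) (hsupp : tsupport ψ ⊆ Ioo 0 T) (hint : ∫ t, ψ t = 0) :
    ∃ φ : ℝ → ℝ, ContDiff ℝ ∞ φ ∧ HasCompactSupport φ ∧ tsupport φ ⊆ Ioo 0 T ∧ deriv φ = ψ := by
  have hder : ∀ t, HasDerivAt (fun x => ∫ y in (0 : ℝ)..x, ψ y) (ψ t) t := fun t =>
    intervalIntegral.integral_hasDerivAt_right (hψ.continuous.intervalIntegrable _ _)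
      hψ.continuous.stronglyMeasurable.stronglyMeasurableAtFilter hψ.continuous.continuousAt
  have hderiv : deriv (fun x => ∫ y in (0 : ℝ)..x, ψ y) = ψ := funext fun t => (hder t).deriv
  obtain ⟨a, b, ha, hb, hab⟩ := exists_Icc_subset_Ioo_of_isCompact hT hc hsupp
  have hzero : ∀ x, x ∉ Icc a b → ψ x = 0 := fun x hx =>
    image_eq_zero_of_notMem_tsupport fun h => hx (hab h)
  have hsub : tsupport (fun x => ∫ y in (0 : ℝ)..x, ψ y) ⊆ Icc a b := by
    refine closure_minimal (fun x hx => ?_) isClosed_Icc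
    by_contra hxab
    refine hx ?_
    -- Left of `a` the integrand vanishes on the whole path from `0`; right of `b` the primitive
    -- equals the total integral, which is zero.
    rcases lt_or_ge x a with h | h
    · refine (intervalIntegral.integral_congr (g := fun _ => 0) fun y hy => hzero y fun hy' => ?_).trans
        (by simp)
      have := hy.2.trans_lt (max_lt ha h)
      exact absurd hy'.1 (not_le.2 this)
    · have hbx : b < x := not_le.1 fun h' => hxab ⟨h, h'⟩
      have hx0 : 0 ≤ x := ha.le.trans h
      refine Eq.trans ?_ hint
      refine intervalIntegral.integral_eq_integral_of_support_subset fun y hy => ?_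
      have : y ∈ Icc a b := by
        by_contra h'
        exact hy (hzero y h')
      exact ⟨ha.trans_le this.1, this.2.trans hbx.le⟩
  refine ⟨_, contDiff_infty_iff_deriv.2 ⟨fun t => (hder t).differentiableAt, by rwa [hderiv]⟩,
    isCompact_Icc.of_isClosed_subset (isClosed_tsupport _) hsub,
    hsub.trans fun x hx => ⟨ha.trans_le hx.1, hx.2.trans_lt hb⟩, hderiv⟩

/-- **Du Bois-Reymond lemma** for continuous functions. -/
lemma eqOn_const_of_integral_deriv_mul_eq_zero (hT : 0 < T) {M : ℝ → ℝ}
    (hM : ContinuousOn M (Icc 0 T))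
    (h : ∀ φ : ℝ → ℝ, ContDiff ℝ ∞ φ → HasCompactSupport φ → tsupport φ ⊆ Ioo 0 T →
      ∫ t in Icc 0 T, deriv φ t * M t = 0) :
    ∀ t ∈ Icc 0 T, M t = M 0 := by
  -- Any normalised bump inside `(0,T)` would do; this one is supported in `[T/4, 3T/4]`.
  set β : ContDiffBump (T / 2) := ⟨T / 8, T / 4, by positivity, by linarith⟩
  set χ : ℝ → ℝ := β.normed volume
  have hχ : ContDiff ℝ ∞ χ := β.contDiff_normed
  have hχc : HasCompactSupport χ := β.hasCompactSupport_normed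
  have hχs : tsupport χ ⊆ Ioo 0 T := by
    rw [β.tsupport_normed_eq, Real.closedBall_eq_Icc]
    intro x hx
    simp only [β, mem_Icc] at hx
    constructor <;> linarith [hx.1, hx.2]
  have hMint : IntegrableOn M (Icc 0 T) := hM.integrableOn_Icc
  have hmul : ∀ g : ℝ → ℝ, ContDiff ℝ ∞ g → IntegrableOn (fun t => g t * M t) (Icc 0 T) :=
    fun g hg => (hg.continuous.continuousOn.mul hM).integrableOn_Icc
  set c := ∫ t in Icc 0 T, χ t * M t
  have hset : ∀ g : ℝ → ℝ, tsupport g ⊆ Ioo 0 T → ∫ t in Icc 0 T, g t = ∫ t, g t := fun g hg =>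
    setIntegral_eq_integral_of_forall_compl_eq_zero fun x hx =>
      image_eq_zero_of_notMem_tsupport fun h' => hx (Ioo_subset_Icc_self (hg h'))
  have hweak : ∀ g : ℝ → ℝ, ContDiff ℝ ∞ g → HasCompactSupport g → tsupport g ⊆ Ioo 0 T →
      ∫ t in Icc 0 T, g t • (M t - c) = 0 := by
    intro g hg hgc hgs
    -- Subtracting the mean of `g` times `χ` leaves a function of zero integral, hence the
    -- derivative of a test function; `c` is the resulting constant value of `M`.
    set ψ : ℝ → ℝ := fun t => g t - (∫ s, g s) * χ t
    have hψ : ContDiff ℝ ∞ ψ := hg.sub (contDiff_const.mul hχ)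
    have hψt : tsupport ψ ⊆ tsupport g ∪ tsupport χ := by
      refine closure_minimal (fun x hx => ?_) ((isClosed_tsupport _).union (isClosed_tsupport _))
      by_contra hx'
      rw [mem_union, not_or] at hx'
      exact hx (by simp [ψ, image_eq_zero_of_notMem_tsupport hx'.1,
        image_eq_zero_of_notMem_tsupport hx'.2])
    have hψint : ∫ t, ψ t = 0 := by
      rw [integral_sub (hg.continuous.integrable_of_hasCompactSupport hgc)
        ((hχ.continuous.integrable_of_hasCompactSupport hχc).const_mul _), integral_const_mul,
        β.integral_normed, mul_one, sub_self]
    obtain ⟨φ, hφ, hφc, hφs, hφd⟩ := exists_testFunction_deriv_eq hT hψ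
      ((hgc.isCompact.union hχc.isCompact).of_isClosed_subset (isClosed_tsupport _) hψt)
      (hψt.trans (union_subset hgs hχs)) hψint
    have h1 := h φ hφ hφc hφs
    have h2 : ∫ t in Icc 0 T, ψ t * M t =
        (∫ t in Icc 0 T, g t * M t) - (∫ s, g s) * c := by
      rw [← integral_const_mul, ← integral_sub (hmul g hg) ((hmul χ hχ).const_mul _)]
      refine integral_congr_ae (.of_forall fun t => ?_)
      simp only [ψ]; ring
    rw [hφd, h2] at h1
    have h3 : ∫ t in Icc 0 T, g t • (M t - c) =
        (∫ t in Icc 0 T, g t * M t) - (∫ s, g s) * c := by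
      rw [← hset g hgs, ← integral_mul_const, ← integral_sub (hmul g hg)
        (hg.continuous.continuousOn.integrableOn_Icc.mul_const _)]
      refine integral_congr_ae (.of_forall fun t => ?_)
      simp only [smul_eq_mul]; ring
    rw [h3, h1]
  have hae := isOpen_Ioo.ae_eq_zero_of_integral_contDiff_smul_eq_zero
    (μ := volume.restrict (Icc 0 T)) (f := fun t => M t - c)
    ((Integrable.locallyIntegrable (hMint.sub (integrable_const c))).locallyIntegrableOn _) hweak
  have hae' : M =ᵐ[volume.restrict (Icc 0 T)] fun _ => c := by
    have : ∀ᵐ t ∂volume.restrict (Icc 0 T), t ∈ Ioo 0 T := by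
      rw [← restrict_Ioo_eq_restrict_Icc]
      exact ae_restrict_mem measurableSet_Ioo
    filter_upwards [hae, this] with t h1 h2 using sub_eq_zero.1 (h1 h2)
  have hEq := Measure.eqOn_Icc_of_ae_eq volume hT.ne hae' hM continuousOn_const
  exact fun t ht => (hEq ht).trans (hEq (left_mem_Icc.2 hT.le)).symm

end DuBoisReymond

/-! ### Constants as elements of `H¹` -/

section ConstantFunction

open Classical in
/-- The constant function `1` in `H¹(S)`, for `S` of finite area. -/
noncomputable def H1.one (S : Set E3) : H1 S :=
  if _h : IsFiniteMeasure (surfaceMeasure S) then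
    ⟨WithLp.toLp 2 (Lp.const 2 (surfaceMeasure S) (1 : ℝ), 0),
      (gradGraph S).le_topologicalClosure ⟨fun _ => 1, contDiff_const, Lp.coeFn_const _ _ _, by
        filter_upwards [Lp.coeFn_zero E3 2 (surfaceMeasure S)] with x hx
        simpa [tangentGrad, gradient] using hx⟩⟩
  -- Test families are indexed by all real `t`, while finite area is known only for `t` in `[0,T]`.
  else 0

variable (S : Set E3)

lemma H1.fn_one [h : IsFiniteMeasure (surfaceMeasure S)] :
    (H1.one S).fn =ᵐ[surfaceMeasure S] fun _ => 1 := by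
  rw [H1.one, dif_pos h]
  exact Lp.coeFn_const _ _ _

lemma H1.grad_one : (H1.one S).grad =ᵐ[surfaceMeasure S] fun _ => 0 := by
  rw [H1.one]
  split_ifs
  · exact Lp.coeFn_zero _ _ _
  · exact Lp.coeFn_zero _ _ _

lemma H1.fn_smul_one [IsFiniteMeasure (surfaceMeasure S)] (c : ℝ) :
    (c • H1.one S).fn =ᵐ[surfaceMeasure S] fun _ => c := by
  have h : (c • H1.one S).fn =ᵐ[surfaceMeasure S] c • (H1.one S).fn :=
    Lp.coeFn_smul c (H1.one S).1.fst
  filter_upwards [h, H1.fn_one S] with x h1 h2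
  rw [h1, Pi.smul_apply, h2, smul_eq_mul, mul_one]

end ConstantFunction

/-! ### Conservation of mass and the contradiction -/

namespace EvolvingSurface

variable {T : ℝ} (G : EvolvingSurface T)

lemma isFiniteMeasure_surfaceMeasure_Γ₀ (hT : 0 ≤ T) :
    IsFiniteMeasure (surfaceMeasure G.Γ₀) := by
  simpa only [G.Γ_zero] using G.isFiniteMeasure_surfaceMeasure (t := 0) ⟨le_rfl, hT⟩

lemma isPullback_smul_one {t : ℝ} (ht : t ∈ Icc 0 T) (c : ℝ) :
    G.IsPullback t (c • H1.one (G.Γ t)) (c • H1.one G.Γ₀) := by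
  have := G.isFiniteMeasure_surfaceMeasure ht
  have := G.isFiniteMeasure_surfaceMeasure_Γ₀ (ht.1.trans ht.2)
  filter_upwards [H1.fn_smul_one G.Γ₀ c,
    (G.ae_surfaceMeasure_iff_ae_Γ₀ ht).1 (H1.fn_smul_one (G.Γ t) c)] with p h1 h2
  rw [h1, h2]

lemma memL2H1_one : G.MemL2H1 fun t => H1.one (G.Γ t) := by
  refine ⟨fun _ => H1.one G.Γ₀, memLp_const _, ?_⟩
  filter_upwards [ae_restrict_mem measurableSet_Icc] with t ht
  simpa only [one_smul] using G.isPullback_smul_one ht 1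

variable {G} {θ : ℝ} {Va : ℝ → E3 → E3} {u₀ : H1 G.Γ₀} {u w : ∀ t, H1 (G.Γ t)}

/-- Testing the first equation with spatially constant functions. -/
lemma IsLogCHSolution.integral_deriv_mul_mass_eq_zero (h : G.IsLogCHSolution θ Va u₀ u w)
    {φ : ℝ → ℝ} (hφ : ContDiff ℝ ∞ φ) (hφc : HasCompactSupport φ)
    (hφs : tsupport φ ⊆ Ioo 0 T) :
    ∫ t in Icc 0 T, deriv φ t * ∫ x, (u t).fn x ∂surfaceMeasure (G.Γ t) = 0 := by
  obtain ⟨v, -, hv, hfirst⟩ := h.first_eq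
  set D : ℝ → ℝ := fun t =>
    ∫ x, (u t).fn x * surfaceDiv (G.Γ t) (G.V t) x ∂surfaceMeasure (G.Γ t)
  have hvD : ∀ᵐ t ∂volume.restrict (Icc 0 T), v t (H1.one (G.Γ t)) = - D t := by
    filter_upwards [hfirst _ G.memL2H1_one, ae_restrict_mem measurableSet_Icc] with t h1 ht
    have := G.isFiniteMeasure_surfaceMeasure ht
    have e1 : G.formG t (u t).fn (H1.one (G.Γ t)).fn = D t := by
      refine integral_congr_ae ?_
      filter_upwards [H1.fn_one (G.Γ t)] with x hx
      rw [hx, mul_one]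
    have e2 : G.formAN Va t (u t).fn (H1.one (G.Γ t)) = 0 := by
      refine integral_eq_zero_of_ae ?_
      filter_upwards [H1.grad_one (G.Γ t)] with x hx
      rw [hx, inner_zero_right, mul_zero, Pi.zero_apply]
    have e3 : G.formAS t (w t) (H1.one (G.Γ t)) = 0 := by
      refine integral_eq_zero_of_ae ?_
      filter_upwards [H1.grad_one (G.Γ t)] with x hx
      rw [hx, inner_zero_right, Pi.zero_apply]
    rw [e1, e2, e3] at h1
    linarith
  have hts : tsupport (fun t => φ t • H1.one G.Γ₀) ⊆ tsupport φ :=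
    closure_mono fun t ht h0 => ht (by simp only [h0, zero_smul])
  have hdiff : Differentiable ℝ φ := hφ.differentiable (by simp)
  have key := hv (fun t => φ t • H1.one G.Γ₀) (hφ.smul contDiff_const)
    (hφc.isCompact.of_isClosed_subset (isClosed_tsupport _) hts) (hts.trans hφs)
    (fun t => φ t • H1.one (G.Γ t)) (fun t => deriv φ t • H1.one (G.Γ t))
    (fun t ht => G.isPullback_smul_one ht _)
    (fun t ht => by
      rw [deriv_smul_const (hdiff t)]
      exact G.isPullback_smul_one ht _)
  have e1 : ∫ t in Icc 0 T, v t (φ t • H1.one (G.Γ t)) = -∫ t in Icc 0 T, φ t * D t := by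
    rw [← integral_neg]
    refine integral_congr_ae ?_
    filter_upwards [hvD] with t ht
    rw [map_smul, ht, smul_eq_mul, mul_neg]
  have e2 : ∫ t in Icc 0 T, ∫ x, (u t).fn x * (deriv φ t • H1.one (G.Γ t)).fn x
        ∂surfaceMeasure (G.Γ t) =
      ∫ t in Icc 0 T, deriv φ t * ∫ x, (u t).fn x ∂surfaceMeasure (G.Γ t) := by
    refine setIntegral_congr_fun measurableSet_Icc fun t ht => ?_
    have := G.isFiniteMeasure_surfaceMeasure ht
    rw [← integral_const_mul]
    refine integral_congr_ae ?_
    filter_upwards [H1.fn_smul_one (G.Γ t) (deriv φ t)] with x hx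
    rw [hx, mul_comm]
  have e3 : ∫ t in Icc 0 T, ∫ x, (u t).fn x * (φ t • H1.one (G.Γ t)).fn x *
        surfaceDiv (G.Γ t) (G.V t) x ∂surfaceMeasure (G.Γ t) =
      ∫ t in Icc 0 T, φ t * D t := by
    refine setIntegral_congr_fun measurableSet_Icc fun t ht => ?_
    have := G.isFiniteMeasure_surfaceMeasure ht
    simp only [D]
    rw [← integral_const_mul]
    refine integral_congr_ae ?_
    filter_upwards [H1.fn_smul_one (G.Γ t) (φ t)] with x hx
    rw [hx]; ring
  rw [e1, e2, e3] at key
  linarith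

/-- Conservation of mass. -/
lemma IsLogCHSolution.integral_eq (h : G.IsLogCHSolution θ Va u₀ u w) (hT : 0 < T) :
    ∀ᵐ t ∂volume.restrict (Icc 0 T),
      ∫ x, (u t).fn x ∂surfaceMeasure (G.Γ t) = ∫ p, u₀.fn p ∂surfaceMeasure G.Γ₀ := by
  obtain ⟨U, hU, hUu, hU0⟩ := h.initial
  have hM : ∀ᵐ t ∂volume.restrict (Icc 0 T), ∫ x, (u t).fn x ∂surfaceMeasure (G.Γ t) =
      ∫ p : G.Γ₀, U t p ∂G.pullMeasure t := by
    filter_upwards [hUu, ae_restrict_mem measurableSet_Icc] with t h1 ht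
    rw [G.integral_surfaceMeasure_eq ht]
    refine integral_congr_ae ?_
    obtain ⟨k, -, hk⟩ := G.exists_pullMeasure_le
    -- `U t` matches `u t` only off a null set of `Γ₀`; absolute continuity carries this to the
    -- measure of `Γ(t)`.
    have hac : G.pullMeasure t ≪ G.pullMeasure 0 :=
      (Measure.absolutelyContinuous_of_le (hk 0 ⟨le_rfl, hT.le⟩ t ht)).trans
        Measure.smul_absolutelyContinuous
    filter_upwards [hac.ae_le ((G.ae_surfaceMeasure_Γ₀_iff hT.le).1 h1)] with p hp
    exact hp.symm
  have hconst := eqOn_const_of_integral_deriv_mul_eq_zero hT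
    (G.continuousOn_integral_pullMeasure hT.le hU) fun φ hφ hφc hφs => by
      refine Eq.trans (integral_congr_ae ?_)
        (h.integral_deriv_mul_mass_eq_zero hφ hφc hφs)
      filter_upwards [hM] with t ht
      rw [ht]
  filter_upwards [hM, ae_restrict_mem measurableSet_Icc] with t h1 ht
  rw [h1, hconst t ht, ← G.integral_surfaceMeasure_Γ₀_eq hT.le]
  exact integral_congr_ae hU0

/-- Strictness survives integration because `1 - |f|` is positive a.e. on a set of nonzero measure.
-/
lemma abs_integral_lt_area {S : Set E3} {f : E3 → ℝ} (hS : area S ≠ 0)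
    (hf : AEStronglyMeasurable f (surfaceMeasure S))
    (h1 : ∀ᵐ x ∂surfaceMeasure S, |f x| < 1) :
    |∫ x, f x ∂surfaceMeasure S| < area S := by
  have hfin : IsFiniteMeasure (surfaceMeasure S) := by
    refine ⟨lt_top_iff_ne_top.2 fun h => hS ?_⟩
    rw [area, Measure.real, h, ENNReal.toReal_top]
  have hint : Integrable f (surfaceMeasure S) :=
    Integrable.of_bound hf 1 (h1.mono fun x hx => hx.le)
  have harea : area S = ∫ _, 1 ∂surfaceMeasure S := by simp [area]
  refine abs_integral_le_integral_abs.trans_lt ?_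
  have hsub : 0 < ∫ x, (1 - |f x|) ∂surfaceMeasure S := by
    rw [integral_pos_iff_support_of_nonneg_ae (h1.mono fun x hx => sub_nonneg.2 hx.le)
      ((integrable_const 1).sub hint.abs)]
    have hsupp : (Function.support fun x => 1 - |f x|) =ᵐ[surfaceMeasure S] univ := by
      filter_upwards [h1] with x hx
      exact propext (iff_of_true (sub_pos.2 hx).ne' trivial)
    rw [measure_congr hsupp]
    refine pos_iff_ne_zero.2 fun h => hS ?_
    rw [area, Measure.real, h, ENNReal.toReal_zero]
  rw [integral_sub (integrable_const 1) hint.abs] at hsub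
  rw [harea]
  linarith

lemma IsLogCHSolution.massRatio_lt_one (h : G.IsLogCHSolution θ Va u₀ u w) (hT : 0 < T) :
    ∀ᵐ t ∂volume.restrict (Icc 0 T), G.massRatio u₀ t < 1 := by
  filter_upwards [h.integral_eq hT, h.abs_lt_one] with t h1 h2
  -- For zero area the ratio is `0` by the convention `x / 0 = 0`.
  rcases eq_or_ne (area (G.Γ t)) 0 with h0 | h0
  · rw [massRatio, h0, div_zero]; exact one_pos
  · have := abs_integral_lt_area h0 (Lp.aestronglyMeasurable (u t).1.fst) h2
    rw [massRatio, ← h1]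
    exact (div_lt_one ((abs_nonneg _).trans_lt this)).2 this

/-- By continuity, `m_{u₀} > 1` at one time excludes `m_{u₀} < 1` almost everywhere. -/
lemma not_ae_massRatio_lt_one (hT : 0 < T) {t₀ : ℝ} (ht₀ : t₀ ∈ Icc 0 T)
    (h : 1 < G.massRatio u₀ t₀) : ¬ ∀ᵐ t ∂volume.restrict (Icc 0 T), G.massRatio u₀ t < 1 := by
  intro hlt
  have h0 : area (G.Γ t₀) ≠ 0 := by
    intro h0
    rw [massRatio, h0, div_zero] at h
    linarith
  have hcont : ContinuousWithinAt (fun t => G.massRatio u₀ t) (Icc 0 T) t₀ :=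
    ContinuousWithinAt.div continuousWithinAt_const (G.continuousOn_area t₀ ht₀) h0
  obtain ⟨O, hO, htO, hsub⟩ := mem_nhdsWithin.1 (hcont.eventually (lt_mem_nhds h))
  -- Here `t₀` may be an endpoint; as a limit of interior points it still yields a nonempty open set
  -- of times with ratio above `1`.
  have hne : (O ∩ Ioo 0 T).Nonempty := by
    rw [← closure_Ioo hT.ne] at ht₀
    exact mem_closure_iff.1 ht₀ O hO htO
  have hpos := (hO.inter isOpen_Ioo).measure_pos volume hne
  rw [ae_restrict_iff' measurableSet_Icc] at hlt
  refine hpos.ne' (measure_mono_null (fun t ht => ?_) hlt)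
  simp only [mem_compl_iff]
  intro hmem
  have h1 : 1 < G.massRatio u₀ t := hsub ⟨ht.1, Ioo_subset_Icc_self ht.2⟩
  exact absurd (hmem (Ioo_subset_Icc_self ht.2)) (not_lt.2 h1.le)

end EvolvingSurface

end EvolvingCH

theorem proposition5p1 (T : ℝ) (hT : 0 < T) (G : EvolvingCH.EvolvingSurface T)
    (θ : ℝ) (hθ : 0 < θ) (hθ' : θ < 1)
    (Va : ℝ → EvolvingCH.E3 → EvolvingCH.E3) (hVa : G.IsAdvectiveVelocity Va)
    (u₀ : EvolvingCH.H1 G.Γ₀)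
    (hu₀ : ∀ᵐ p ∂EvolvingCH.surfaceMeasure G.Γ₀, |u₀.fn p| ≤ 1)
    (hm : (∃ I : Set ℝ, I ⊆ Set.Icc 0 T ∧ 0 < MeasureTheory.volume I ∧
        ∀ t ∈ I, 1 ≤ G.massRatio u₀ t) ∨
      (∃ t ∈ Set.Icc 0 T, 1 < G.massRatio u₀ t)) :
    ¬ ∃ u w : ∀ t : ℝ, EvolvingCH.H1 (G.Γ t), G.IsLogCHSolution θ Va u₀ u w := by

  rintro ⟨u, w, h⟩
  have hlt := h.massRatio_lt_one hT
  rcases hm with ⟨I, hI, hpos, hge⟩ | ⟨t, ht, hgt⟩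
  · rw [ae_restrict_iff' measurableSet_Icc] at hlt
    -- Monotonicity of the outer measure suffices, so `I` need not be measurable.
    refine hpos.ne' (measure_mono_null (fun t ht => ?_) hlt)
    simp only [mem_compl_iff]
    exact fun hmem => absurd (hmem (hI ht)) (not_lt.2 (hge t ht))
  · exact EvolvingCH.EvolvingSurface.not_ae_massRatio_lt_one hT ht hgt hlt
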